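/- Let $E=(E^0,E^1,r,s)$ be a finite directed graph (finitely many vertices and edges, with range and source maps $r,s:E^1\to E^0$; loops and parallel edges are allowed) and let $K$ be any field. The Leavitt path algebra $L_K(E)$ is the $K$-algebra generated by pairwise orthogonal idempotents $v$ $(v\in E^0)$ and elements $e,e^*$ $(e\in E^1)$ subject to $s(e)e=e=er(e)$, $r(e)e^*=e^*=e^*s(e)$, $e^*e=r(e)$, $e^*f=0$ for edges $e\neq f$, and $v=\sum_{s(e)=v}ee^*$ for every vertex $v$ that emits at least one edge; it is unital with $1=\sum_{v\in E^0}v$. An infinite path is a sequence $p=e_1e_2e_3\cdots$ of edges with $r(e_i)=s(e_{i+1})$ for all $i$; put $s(p)=s(e_1)$ and $\tau_{>n}(p)=e_{n+1}e_{n+2}\cdots$. Two infinite paths $p,q$ are tail-equivalent if $\tau_{>m}(p)=\tau_{>n}(q)$ for some positive integers $m,n$, and $[p]$ denotes the tail-equivalence class of $p$. The (simple) Chen module $V_{[p]}$ is the $K$-vector space with basis $[p]$ and with the left $L_K(E)$-action given, for $q\in[p]$, $v\in E^0$ and $e\in E^1$, by: $v\cdot q=q$ if $v=s(q)$ and $0$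 otherwise; $e\cdot q=eq$ if $r(e)=s(q)$ and $0$ otherwise; $e^*\cdot q=\tau_{>1}(q)$ if the first edge of $q$ is $e$ and $0$ otherwise. A closed path is a finite path $c=e_1\cdots e_n$ with $n\ge 1$, $r(e_i)=s(e_{i+1})$ for $1\le i<n$, and $r(e_n)=s(e_1)$. Let $p$ be an infinite path in $E$. Then the left $L_K(E)$-module $V_{[p]}$ is finitely presented if and only if $p$ is tail-equivalent to the rational infinite path $ccc\cdots$ for some closed path $c$ in $E$. -/

import Mathlib

universe u v w

/-- A directed graph with vertex set `V` and edge set `E`: every edge has a source and a range.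
Loops and parallel edges are allowed. -/
structure DirectedGraph (V : Type u) (E : Type v) where
  /-- the source of an edge -/
  s : E → V
  /-- the range of an edge -/
  r : E → V

namespace DirectedGraph

/-! ### Infinite paths and closed paths -/

section Paths

variable {V : Type u} {E : Type v} (G : DirectedGraph V E)

/-- An infinite path `e₀ e₁ e₂ ⋯`. -/
@[ext]
structure InfinitePath where
  /-- the edges of the path, indexed from `0` -/
  edge : ℕ → E
  /-- consecutive edges are composable -/
  composable : ∀ n, G.r (edge n) = G.s (edge (n + 1))

/-- A closed path `e₁ ⋯ eₙ`, `n ≥ 1`. It may pass through its vertices several times. -/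
@[ext]
structure ClosedPath where
  /-- the edges of the path -/
  edges : List E
  /-- the path has positive length -/
  ne_nil : edges ≠ []
  /-- consecutive edges are composable -/
  composable : edges.IsChain (fun e f => G.r e = G.s f)
  /-- the range of the last edge is the source of the first edge -/
  closed : G.r (edges.getLast ne_nil) = G.s (edges.head ne_nil)

variable {G}

namespace InfinitePath

/-- The source of an infinite path. -/
def source (p : G.InfinitePath) : V := G.s (p.edge 0)

/-- The tail that is left when the first `n` edges are removed. -/
def drop (n : ℕ) (p : G.InfinitePath) : G.InfinitePath where
  edge i := p.edge (n + i)
  composable i := p.composable (n + i)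

/-- The infinite path `e p`, for an edge `e` with range the source of `p`. -/
def cons (e : E) (p : G.InfinitePath) (h : G.r e = p.source) : G.InfinitePath where
  edge
    | 0 => e
    | n + 1 => p.edge n
  composable
    | 0 => h
    | n + 1 => p.composable n

/-- Two infinite paths are tail-equivalent if they agree after the removal of suitable
(not necessarily equally long) non-trivial initial segments. -/
def TailEquivalent (p q : G.InfinitePath) : Prop :=
  ∃ m n : ℕ, 0 < m ∧ 0 < n ∧ p.drop m = q.drop n

theorem drop_drop (m n : ℕ) (p : G.InfinitePath) : (p.drop m).drop n = p.drop (m + n) := by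
  ext i
  simp [drop, Nat.add_assoc]

theorem drop_cons (e : E) (p : G.InfinitePath) (h : G.r e = p.source) (n : ℕ) :
    (cons e p h).drop (n + 1) = p.drop n := by
  ext i
  have : n + 1 + i = (n + i) + 1 := by omega
  simp only [drop, cons, this]

theorem drop_one_cons (e : E) (p : G.InfinitePath) (h : G.r e = p.source) :
    (cons e p h).drop 1 = p := by
  rw [show 1 = 0 + 1 from rfl, drop_cons]
  ext i
  simp [drop]

theorem source_drop_one (p : G.InfinitePath) : (p.drop 1).source = G.r (p.edge 0) :=
  (p.composable 0).symm

theorem cons_drop_one (p : G.InfinitePath) :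
    cons (p.edge 0) (p.drop 1) p.source_drop_one.symm = p := by
  ext i
  cases i with
  | zero => rfl
  | succ i => simp [cons, drop, Nat.add_comm]

theorem TailEquivalent.refl (p : G.InfinitePath) : p.TailEquivalent p :=
  ⟨1, 1, one_pos, one_pos, rfl⟩

theorem TailEquivalent.cons_left {p q : G.InfinitePath} (h : q.TailEquivalent p) (e : E)
    (he : G.r e = q.source) : (cons e q he).TailEquivalent p := by
  obtain ⟨m, n, hm, hn, hmn⟩ := h
  exact ⟨m + 1, n, Nat.succ_pos _, hn, by rw [drop_cons, hmn]⟩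

theorem TailEquivalent.drop_one_left {p q : G.InfinitePath} (h : q.TailEquivalent p) :
    (q.drop 1).TailEquivalent p := by
  obtain ⟨m, n, hm, hn, hmn⟩ := h
  refine ⟨m, n + 1, hm, Nat.succ_pos _, ?_⟩
  rw [drop_drop, Nat.add_comm, ← drop_drop, hmn, drop_drop]

end InfinitePath

theorem ClosedPath.length_pos (c : G.ClosedPath) : 0 < c.edges.length :=
  List.length_pos_of_ne_nil c.ne_nil

/-- The rational infinite path `c c c ⋯`. -/
def ClosedPath.infinitePower (c : G.ClosedPath) : G.InfinitePath where
  edge n := c.edges[n % c.edges.length]'(Nat.mod_lt _ c.length_pos)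
  composable n := by
    have hlt := Nat.mod_lt n c.length_pos
    by_cases h : n % c.edges.length + 1 < c.edges.length
    · have h2 : (n + 1) % c.edges.length = n % c.edges.length + 1 := by
        rw [← Nat.mod_add_mod, Nat.mod_eq_of_lt h]
      simp only [h2]
      exact (List.isChain_iff_getElem.mp c.composable) _ h
    · have h1 : n % c.edges.length = c.edges.length - 1 := by omega
      have h2 : (n + 1) % c.edges.length = 0 := by
        have := Nat.div_add_mod n c.edges.length
        apply Nat.mod_eq_zero_of_dvd
        refine ⟨n / c.edges.length + 1, ?_⟩
        rw [Nat.mul_add]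
        omega
      have h3 := c.closed
      rw [List.getLast_eq_getElem, List.head_eq_getElem] at h3
      simp only [h1, h2]
      exact h3

end Paths

/-! ### The Leavitt path algebra of a finite graph -/

section Algebra

/-- The generators of a Leavitt path algebra: vertices, edges and ghost edges. -/
inductive Generator (V : Type u) (E : Type v) where
  | vertex (x : V)
  | edge (e : E)
  | ghost (e : E)

variable {V : Type u} {E : Type v} [Fintype V] [Fintype E] (G : DirectedGraph V E)
  (K : Type w) [Field K]

open FreeAlgebra Generator in
open scoped Classical in
/-- The defining relations of the Leavitt path algebra of a finite graph. Because the vertex set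
is finite, the algebra has an identity, namely the sum of the vertices; `sum_vertex` says that
this is the identity of the ambient free unital algebra. -/
inductive LeavittRel :
    FreeAlgebra K (Generator V E) → FreeAlgebra K (Generator V E) → Prop
  | sum_vertex : LeavittRel (∑ x : V, ι K (vertex x)) 1
  | vertex_idem (x : V) : LeavittRel (ι K (vertex x) * ι K (vertex x)) (ι K (vertex x))
  | vertex_orth (x y : V) (h : x ≠ y) : LeavittRel (ι K (vertex x) * ι K (vertex y)) 0
  | source_edge (e : E) : LeavittRel (ι K (vertex (G.s e)) * ι K (edge e)) (ι K (edge e))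
  | edge_range (e : E) : LeavittRel (ι K (edge e) * ι K (vertex (G.r e))) (ι K (edge e))
  | range_ghost (e : E) : LeavittRel (ι K (vertex (G.r e)) * ι K (ghost e)) (ι K (ghost e))
  | ghost_source (e : E) : LeavittRel (ι K (ghost e) * ι K (vertex (G.s e))) (ι K (ghost e))
  | ck1_same (e : E) : LeavittRel (ι K (ghost e) * ι K (edge e)) (ι K (vertex (G.r e)))
  | ck1_ne (e f : E) (h : e ≠ f) : LeavittRel (ι K (ghost e) * ι K (edge f)) 0
  | ck2 (x : V) (hx : ∃ e, G.s e = x) :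
      LeavittRel (ι K (vertex x)) (∑ e : E with G.s e = x, ι K (edge e) * ι K (ghost e))

/-- The Leavitt path algebra `L_K(G)` of a finite graph `G`. -/
abbrev LeavittPathAlgebra : Type (max u v w) := RingQuot (G.LeavittRel K)

/-- The image of a generator in the Leavitt path algebra. -/
noncomputable def LeavittPathAlgebra.of (g : Generator V E) : G.LeavittPathAlgebra K :=
  RingQuot.mkAlgHom K (G.LeavittRel K) (FreeAlgebra.ι K g)

end Algebra

/-! ### The Chen module of an infinite path -/

section Chen

variable {V : Type u} {E : Type v} {G : DirectedGraph V E}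

/-- The class `[p]` of the infinite paths that are tail-equivalent to `p`. -/
abbrev TailClass (p : G.InfinitePath) : Type v := {q : G.InfinitePath // q.TailEquivalent p}

variable (K : Type w) [Field K] (p : G.InfinitePath)

/-- The vector space `V_[p]` over `K` with basis the tail-equivalence class `[p]`. -/
def ChenModule : Type (max v w) := TailClass p →₀ K

noncomputable instance : AddCommGroup (ChenModule K p) :=
  inferInstanceAs (AddCommGroup (TailClass p →₀ K))

noncomputable instance : Module K (ChenModule K p) :=
  inferInstanceAs (Module K (TailClass p →₀ K))

namespace ChenModule

variable {p}

/-- The basis vector of `V_[p]` that belongs to the path `q ∈ [p]`. -/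
noncomputable def basisVec (q : TailClass p) : ChenModule K p :=
  (Finsupp.single q 1 : TailClass p →₀ K)

/-- The `K`-linear endomorphism of `V_[p]` with given values on the basis `[p]`. -/
noncomputable def extend (f : TailClass p → ChenModule K p) :
    Module.End K (ChenModule K p) :=
  (Finsupp.linearCombination K f : (TailClass p →₀ K) →ₗ[K] ChenModule K p)

theorem extend_basisVec (f : TailClass p → ChenModule K p) (q : TailClass p) :
    extend K f (basisVec K q) = f q := by
  change Finsupp.linearCombination K f (Finsupp.single q 1) = f q
  simp

variable {K} in
theorem end_ext {f g : Module.End K (ChenModule K p)}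
    (h : ∀ q, f (basisVec K q) = g (basisVec K q)) : f = g := by
  refine Finsupp.lhom_ext' (M := K) (R := K) (α := TailClass p) fun q => ?_
  ext
  exact h q

open scoped Classical in
/-- The action of the generators on the basis `[p]`: a vertex `x` fixes `q` if `x` is the source
of `q`; an edge `e` maps `q` to `e q` if this is a path; a ghost edge `e*` removes the first edge
of `q` if this edge is `e`. All other products are zero. -/
noncomputable def genAct : Generator V E → TailClass p → ChenModule K p
  | .vertex x, q => if q.1.source = x then basisVec K q else 0
  | .edge e, q =>
      if h : G.r e = q.1.source then basisVec K ⟨q.1.cons e h, q.2.cons_left e h⟩ else 0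
  | .ghost e, q =>
      if q.1.edge 0 = e then basisVec K ⟨q.1.drop 1, q.2.drop_one_left⟩ else 0

/-- The action of the free algebra on `V_[p]`. -/
noncomputable def freeAct :
    FreeAlgebra K (Generator V E) →ₐ[K] Module.End K (ChenModule K p) :=
  FreeAlgebra.lift K fun g => extend K (genAct K g)

theorem freeAct_ι (g : Generator V E) (q : TailClass p) :
    freeAct K (FreeAlgebra.ι K g) (basisVec K q) = genAct K g q := by
  simp [freeAct, extend_basisVec]

variable [Fintype V] [Fintype E]

theorem freeAct_rel {a b : FreeAlgebra K (Generator V E)} (h : G.LeavittRel K a b) :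
    freeAct K (p := p) a = freeAct K b := by
  classical
  refine end_ext fun q => ?_
  cases h with
  | sum_vertex => simp [freeAct_ι, genAct]
  | vertex_idem x => by_cases h : q.1.source = x <;> simp [freeAct_ι, genAct, h]
  | vertex_orth x y hxy =>
    by_cases h : q.1.source = y
    · have : q.1.source ≠ x := fun h' => hxy (h'.symm.trans h)
      simp [freeAct_ι, genAct, h, hxy.symm]
    · simp [freeAct_ι, genAct, h]
  | source_edge e =>
    by_cases h : G.r e = q.1.source
    · simp [freeAct_ι, genAct, h, InfinitePath.cons, InfinitePath.source]
    · simp [freeAct_ι, genAct, h]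
  | edge_range e =>
    by_cases h : G.r e = q.1.source
    · simp [freeAct_ι, genAct, h]
    · simp [freeAct_ι, genAct, h, Ne.symm h]
  | range_ghost e =>
    by_cases h : q.1.edge 0 = e
    · subst h
      simp [freeAct_ι, genAct, InfinitePath.source_drop_one]
    · simp [freeAct_ι, genAct, h]
  | ghost_source e =>
    by_cases h : q.1.edge 0 = e
    · simp [freeAct_ι, genAct, InfinitePath.source, h]
    · by_cases h' : q.1.source = G.s e <;> simp [freeAct_ι, genAct, h, h']
  | ck1_same e =>
    by_cases h : G.r e = q.1.source
    · have h1 : (q.1.cons e h).edge 0 = e := rfl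
      simp [freeAct_ι, genAct, h, h1, InfinitePath.drop_one_cons]
    · simp [freeAct_ι, genAct, h, Ne.symm h]
  | ck1_ne e f hef =>
    by_cases h : G.r f = q.1.source
    · have h1 : (q.1.cons f h).edge 0 = f := rfl
      simp [freeAct_ι, genAct, h, h1, hef.symm]
    · simp [freeAct_ι, genAct, h]
  | ck2 x hx =>
    have key (e : E) : freeAct K (FreeAlgebra.ι K (.edge e)) (genAct K (.ghost e) q) =
        if q.1.edge 0 = e then basisVec K q else 0 := by
      by_cases h : q.1.edge 0 = e
      · subst h
        have h1 := q.1.source_drop_one.symm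
        have h2 := q.1.cons_drop_one
        simp [freeAct_ι, genAct, h1, h2]
      · simp [genAct, h]
    simp only [freeAct_ι, map_sum, map_mul, LinearMap.sum_apply, Module.End.mul_apply, key,
      Finset.sum_ite_eq, Finset.mem_filter_univ]
    simp only [genAct, InfinitePath.source]
    by_cases h : G.s (q.1.edge 0) = x <;> simp [h]

/-- The representation of the Leavitt path algebra on `V_[p]`. -/
noncomputable def act : G.LeavittPathAlgebra K →ₐ[K] Module.End K (ChenModule K p) :=
  RingQuot.liftAlgHom K ⟨freeAct K, fun _ _ h => freeAct_rel K h⟩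

/-- The left module structure of `V_[p]` over the Leavitt path algebra. -/
noncomputable instance : Module (G.LeavittPathAlgebra K) (ChenModule K p) :=
  Module.compHom (ChenModule K p) (act K (p := p)).toRingHom

theorem of_smul_basisVec (g : Generator V E) (q : TailClass p) :
    LeavittPathAlgebra.of G K g • basisVec K q = genAct K g q := by
  change act K (RingQuot.mkAlgHom K (G.LeavittRel K) (FreeAlgebra.ι K g)) (basisVec K q) = _
  rw [act, RingQuot.liftAlgHom_mkAlgHom_apply]
  exact freeAct_ι K g q

end ChenModule

end Chen

end DirectedGraph

namespace DirectedGraph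

open LeavittPathAlgebra Generator

section Paths

variable {V : Type u} {E : Type v} {G : DirectedGraph V E}

namespace InfinitePath

theorem drop_edge (p : G.InfinitePath) (n i : ℕ) : (p.drop n).edge i = p.edge (n + i) := rfl

theorem drop_zero (p : G.InfinitePath) : p.drop 0 = p := by
  ext i
  simp [drop]

theorem iterate_drop_one (p : G.InfinitePath) (n : ℕ) :
    (InfinitePath.drop 1)^[n] p = p.drop n := by
  induction n with
  | zero => exact p.drop_zero.symm
  | succ n ih => rw [Function.iterate_succ_apply', ih, drop_drop]

theorem TailEquivalent.symm {p q : G.InfinitePath} (h : p.TailEquivalent q) :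
    q.TailEquivalent p := by
  obtain ⟨m, n, hm, hn, hmn⟩ := h
  exact ⟨n, m, hn, hm, hmn.symm⟩

theorem TailEquivalent.trans {p q t : G.InfinitePath} (h : p.TailEquivalent q)
    (h' : q.TailEquivalent t) : p.TailEquivalent t := by
  obtain ⟨m, n, hm, hn, hmn⟩ := h
  obtain ⟨m', n', hm', hn', hmn'⟩ := h'
  refine ⟨m + m', n' + n, by omega, by omega, ?_⟩
  rw [← drop_drop, hmn, drop_drop, Nat.add_comm n, ← drop_drop, hmn', drop_drop]

theorem TailEquivalent.drop_left {p q : G.InfinitePath} (h : p.TailEquivalent q) (n : ℕ) :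
    (p.drop n).TailEquivalent q := by
  refine TailEquivalent.trans ⟨1, n + 1, one_pos, n.succ_pos, ?_⟩ h
  rw [drop_drop]

theorem drop_add_of_drop_eq {p q : G.InfinitePath} {a b : ℕ} (h : q.drop a = p.drop b) (k : ℕ) :
    q.drop (a + k) = p.drop (b + k) := by
  rw [← drop_drop, h, drop_drop]

/-- A path two of whose tails agree is tail-equivalent to a rational path. -/
theorem exists_tailEquivalent_infinitePower (p : G.InfinitePath) {i j : ℕ} (hij : i < j)
    (h : p.drop i = p.drop j) : ∃ c : G.ClosedPath, p.TailEquivalent c.infinitePower := by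
  have hpos : 0 < j - i := by omega
  have hper : Function.Periodic (p.drop i).edge (j - i) := fun n => by
    conv_rhs => rw [h]
    simp only [drop_edge]
    congr 1
    omega
  let c : G.ClosedPath :=
    { edges := List.ofFn fun k : Fin (j - i) => (p.drop i).edge k
      ne_nil := by
        rw [Ne, List.ofFn_eq_nil_iff]
        omega
      composable := by
        rw [List.isChain_iff_getElem]
        intro k hk
        simpa using (p.drop i).composable k
      closed := by
        have h1 := (p.drop i).composable (j - i - 1)
        have h2 := hper 0
        rw [Nat.zero_add] at h2
        rw [Nat.sub_add_cancel hpos, h2] at h1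
        rw [List.getLast_eq_getElem, List.head_eq_getElem]
        simpa using h1 }
  have hc : c.infinitePower = p.drop i := by
    ext n
    simp [c, ClosedPath.infinitePower, hper.map_mod_nat]
  refine ⟨c, i + 1, 1, i.succ_pos, one_pos, ?_⟩
  rw [hc, drop_drop]

/-- A path without repeated tails passes infinitely often through a
vertex that emits several edges. -/
theorem exists_branch [Finite V] (p : G.InfinitePath)
    (hp : Function.Injective fun n => p.drop n) (b : ℕ) :
    ∃ i, b ≤ i ∧ ∃ f, G.s f = G.s (p.edge i) ∧ f ≠ p.edge i := by
  by_contra! hno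
  obtain ⟨k, l, hkl, hs⟩ := Finite.exists_ne_map_eq_of_infinite fun k => G.s (p.edge (b + k))
  have key (n : ℕ) : p.edge (b + k + n) = p.edge (b + l + n) := by
    induction n with
    | zero => exact hno (b + l) (by omega) _ hs
    | succ n ih =>
      refine hno (b + l + (n + 1)) (by omega) _ ?_
      have h1 := p.composable (b + k + n)
      have h2 := p.composable (b + l + n)
      rw [Nat.add_assoc (b + k)] at h1
      rw [Nat.add_assoc (b + l)] at h2
      rw [← h1, ← h2, ih]
  have : b + k = b + l := hp (InfinitePath.ext (funext key))
  omega

end InfinitePath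

theorem ClosedPath.drop_infinitePower (c : G.ClosedPath) :
    c.infinitePower.drop c.edges.length = c.infinitePower := by
  ext n
  simp [InfinitePath.drop, ClosedPath.infinitePower]

/-- For every vertex `x` that emits an edge, an enumeration of the pairs consisting of an edge
with source `x` and a natural number. -/
theorem exists_branching (G : DirectedGraph V E) [Finite E] [Nonempty E] : ∃ (σ : V → ℕ → E × ℕ) (ρ : E → ℕ → ℕ),
    (∀ e m, σ (G.s e) (ρ e m) = (e, m)) ∧
    ∀ x n, (∃ e, G.s e = x) → G.s (σ x n).1 = x ∧ ρ (σ x n).1 (σ x n).2 = n := by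
  classical
  have key (x : V) : ∃ (σ : ℕ → E × ℕ) (ρ : E → ℕ → ℕ),
      (∀ e m, G.s e = x → σ (ρ e m) = (e, m)) ∧
      ∀ n, (∃ e, G.s e = x) → G.s (σ n).1 = x ∧ ρ (σ n).1 (σ n).2 = n := by
    by_cases hx : ∃ e, G.s e = x
    · have : Nonempty {f // G.s f = x} := nonempty_subtype.2 hx
      obtain ⟨τ⟩ : Nonempty (ℕ ≃ {f // G.s f = x} × ℕ) := nonempty_equiv_of_countable
      refine ⟨fun n => ((τ n).1.1, (τ n).2),
        fun e m => if h : G.s e = x then τ.symm (⟨e, h⟩, m) else 0, fun e m he => ?_,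
        fun n _ => ⟨(τ n).1.2, ?_⟩⟩
      · simp [he]
      · simp [(τ n).1.2]
    · exact ⟨fun _ => (Classical.arbitrary E, 0), fun _ _ => 0,
        fun e _ he => absurd ⟨e, he⟩ hx, fun _ h => absurd h hx⟩
  choose σ ρ hσ hρ using key
  refine ⟨σ, fun e => ρ (G.s e) e, fun e m => hσ _ e m rfl, fun x n hx => ?_⟩
  obtain ⟨h1, h2⟩ := hρ x n hx
  exact ⟨h1, by simpa only [h1] using h2⟩

end Paths

section Algebra

variable {V : Type u} {E : Type v} [Fintype V] [Fintype E] (G : DirectedGraph V E)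
  (K : Type w) [Field K]

namespace LeavittPathAlgebra

theorem induction {P : G.LeavittPathAlgebra K → Prop}
    (algebraMap : ∀ k, P (algebraMap K _ k)) (of : ∀ g, P (of G K g))
    (mul : ∀ a b, P a → P b → P (a * b)) (add : ∀ a b, P a → P b → P (a + b)) (a) : P a := by
  obtain ⟨a, rfl⟩ := RingQuot.mkAlgHom_surjective K (G.LeavittRel K) a
  induction a with
  | grade0 k => simpa using algebraMap k
  | grade1 g => exact of g
  | mul a b ha hb => simpa using mul _ _ ha hb
  | add a b ha hb => simpa using add _ _ ha hb

theorem vertex_mul_self (x : V) :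
    of G K (vertex x) * of G K (vertex x) = of G K (vertex x) := by
  simpa [of] using RingQuot.mkAlgHom_rel K (LeavittRel.vertex_idem (G := G) (K := K) x)

theorem vertex_mul_of_ne {x y : V} (h : x ≠ y) :
    of G K (vertex x) * of G K (vertex y) = 0 := by
  simpa [of] using RingQuot.mkAlgHom_rel K (LeavittRel.vertex_orth (G := G) (K := K) x y h)

theorem source_mul_edge (e : E) :
    of G K (vertex (G.s e)) * of G K (edge e) = of G K (edge e) := by
  simpa [of] using RingQuot.mkAlgHom_rel K (LeavittRel.source_edge (G := G) (K := K) e)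

theorem edge_mul_range (e : E) :
    of G K (edge e) * of G K (vertex (G.r e)) = of G K (edge e) := by
  simpa [of] using RingQuot.mkAlgHom_rel K (LeavittRel.edge_range (G := G) (K := K) e)

theorem ghost_mul_source (e : E) :
    of G K (ghost e) * of G K (vertex (G.s e)) = of G K (ghost e) := by
  simpa [of] using RingQuot.mkAlgHom_rel K (LeavittRel.ghost_source (G := G) (K := K) e)

theorem range_mul_ghost (e : E) :
    of G K (vertex (G.r e)) * of G K (ghost e) = of G K (ghost e) := by
  simpa [of] using RingQuot.mkAlgHom_rel K (LeavittRel.range_ghost (G := G) (K := K) e)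

theorem ghost_mul_edge (e : E) :
    of G K (ghost e) * of G K (edge e) = of G K (vertex (G.r e)) := by
  simpa [of] using RingQuot.mkAlgHom_rel K (LeavittRel.ck1_same (G := G) (K := K) e)

theorem ghost_mul_edge_of_ne {e f : E} (h : e ≠ f) :
    of G K (ghost e) * of G K (edge f) = 0 := by
  simpa [of] using RingQuot.mkAlgHom_rel K (LeavittRel.ck1_ne (G := G) (K := K) e f h)

/-! ### Vertices are nonzero -/

open scoped Classical in
/-- The action of the generators on the functions `V × ℕ → K` that is defined by a
branching `σ`, `ρ` of `V × ℕ`. -/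
noncomputable def branchingAct (σ : V → ℕ → E × ℕ) (ρ : E → ℕ → ℕ) :
    Generator V E → Module.End K (V → ℕ → K)
  | .vertex x =>
    { toFun := fun F y n => if y = x then F y n else 0
      map_add' := fun F F' => by ext y n; by_cases h : y = x <;> simp [h]
      map_smul' := fun k F => by ext y n; by_cases h : y = x <;> simp [h] }
  | .edge e =>
    { toFun := fun F y n =>
        if y = G.s e ∧ (σ (G.s e) n).1 = e then F (G.r e) (σ (G.s e) n).2 else 0
      map_add' := fun F F' => by ext y n; dsimp; split_ifs <;> simp
      map_smul' := fun k F => by ext y n; dsimp; split_ifs <;> simp }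
  | .ghost e =>
    { toFun := fun F y n => if y = G.r e then F (G.s e) (ρ e n) else 0
      map_add' := fun F F' => by ext y n; by_cases h : y = G.r e <;> simp [h]
      map_smul' := fun k F => by ext y n; by_cases h : y = G.r e <;> simp [h] }

theorem lift_branchingAct_rel {σ : V → ℕ → E × ℕ} {ρ : E → ℕ → ℕ}
    (hσ : ∀ e m, σ (G.s e) (ρ e m) = (e, m))
    (hρ : ∀ x n, (∃ e, G.s e = x) → G.s (σ x n).1 = x ∧ ρ (σ x n).1 (σ x n).2 = n)
    {a b : FreeAlgebra K (Generator V E)} (h : G.LeavittRel K a b) :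
    FreeAlgebra.lift K (branchingAct G K σ ρ) a = FreeAlgebra.lift K (branchingAct G K σ ρ) b := by
  classical
  refine LinearMap.ext fun F => funext fun y => funext fun n => ?_
  cases h with
  | sum_vertex => simp [branchingAct, LinearMap.sum_apply, Finset.sum_apply]
  | vertex_idem x => simp +contextual [branchingAct]
  | vertex_orth x z hxz => by_cases h : y = x <;> simp [branchingAct, h, hxz]
  | source_edge e => by_cases h : y = G.s e <;> simp [branchingAct, h]
  | edge_range e => simp [branchingAct]
  | range_ghost e => by_cases h : y = G.r e <;> simp [branchingAct, h]
  | ghost_source e => simp [branchingAct]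
  | ck1_same e => by_cases h : y = G.r e <;> simp [branchingAct, hσ, h]
  | ck1_ne e f hef =>
    by_cases h : G.s e = G.s f
    · have := hσ e n
      rw [h] at this
      simp [branchingAct, this, h, hef]
    · simp [branchingAct, h]
  | ck2 x hx =>
    simp only [map_mul, map_sum, FreeAlgebra.lift_ι_apply, LinearMap.sum_apply,
      Finset.sum_apply, Module.End.mul_apply]
    by_cases h : y = x
    · subst h
      obtain ⟨h1, h2⟩ := hρ y n hx
      rw [Finset.sum_eq_single (σ y n).1]
      · simp [branchingAct, h1, h2]
      · intro f hf hne
        rw [Finset.mem_filter_univ] at hf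
        simp [branchingAct, hf, hne.symm]
      · intro hf
        simp [h1] at hf
    · rw [Finset.sum_eq_zero]
      · simp [branchingAct, h]
      · intro f hf
        rw [Finset.mem_filter_univ] at hf
        simp [branchingAct, hf, h]

theorem ghost_ne_zero (e : E) : of G K (ghost e) ≠ 0 := by
  intro h
  have : Nonempty E := ⟨e⟩
  obtain ⟨σ, ρ, hσ, hρ⟩ := exists_branching G
  have h' := congr_arg (RingQuot.liftAlgHom K
    ⟨FreeAlgebra.lift K (branchingAct G K σ ρ),
      fun _ _ h => lift_branchingAct_rel G K hσ hρ h⟩) h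
  rw [of, RingQuot.liftAlgHom_mkAlgHom_apply, FreeAlgebra.lift_ι_apply, map_zero] at h'
  have h2 := congr_fun (congr_fun (LinearMap.congr_fun h' fun _ _ => 1) (G.r e)) 0
  simp [branchingAct] at h2

/-! ### Initial segments of an infinite path -/

variable {G}

/-- The initial segment of length `b` of the path `q`. -/
noncomputable def initial (q : G.InfinitePath) : ℕ → G.LeavittPathAlgebra K
  | 0 => of G K (vertex q.source)
  | b + 1 => initial q b * of G K (edge (q.edge b))

/-- The ghost path of the initial segment of length `b` of the path `q`. -/
noncomputable def ghostInitial (q : G.InfinitePath) : ℕ → G.LeavittPathAlgebra K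
  | 0 => of G K (vertex q.source)
  | b + 1 => of G K (ghost (q.edge b)) * ghostInitial q b

theorem initial_mul_vertex (q : G.InfinitePath) (b : ℕ) :
    initial K q b * of G K (vertex (G.s (q.edge b))) = initial K q b := by
  cases b with
  | zero => exact vertex_mul_self G K _
  | succ b => rw [initial, mul_assoc, ← q.composable b, edge_mul_range]

theorem vertex_mul_initial (q : G.InfinitePath) (b : ℕ) :
    of G K (vertex q.source) * initial K q b = initial K q b := by
  induction b with
  | zero => exact vertex_mul_self G K _
  | succ b ih => rw [initial, ← mul_assoc, ih]

theorem ghostInitial_mul_initial (q : G.InfinitePath) (b : ℕ) :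
    ghostInitial K q b * initial K q b = of G K (vertex (G.s (q.edge b))) := by
  induction b with
  | zero => exact vertex_mul_self G K _
  | succ b ih =>
    rw [ghostInitial, initial, mul_assoc, ← mul_assoc (ghostInitial K q b), ih, source_mul_edge,
      ghost_mul_edge, q.composable b]

theorem initial_add (q : G.InfinitePath) (b k : ℕ) :
    initial K q (b + k) = initial K q b * initial K (q.drop b) k := by
  induction k with
  | zero => exact (initial_mul_vertex K q b).symm
  | succ k ih => rw [← Nat.add_assoc, initial, ih, initial, mul_assoc]; rfl

theorem vertex_mul_ghostInitial (q : G.InfinitePath) (b : ℕ) :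
    of G K (vertex (G.s (q.edge b))) * ghostInitial K q b = ghostInitial K q b := by
  cases b with
  | zero => exact vertex_mul_self G K _
  | succ b => rw [ghostInitial, ← mul_assoc, ← q.composable b, range_mul_ghost]

theorem ghostInitial_add (q : G.InfinitePath) (b k : ℕ) :
    ghostInitial K q (b + k) = ghostInitial K (q.drop b) k * ghostInitial K q b := by
  induction k with
  | zero => exact (vertex_mul_ghostInitial K q b).symm
  | succ k ih => rw [← Nat.add_assoc, ghostInitial, ih, ghostInitial, mul_assoc]; rfl

/-- If `m` lies in `α M` for every initial segment `α` of `q`, then the elements `α* m` are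
compatible. -/
theorem ghostInitial_smul_eq {M : Type*} [AddCommGroup M] [Module (G.LeavittPathAlgebra K) M]
    (q : G.InfinitePath) {m : M} (b : ℕ) (hm : ∃ y : M, initial K q (b + 1) • y = m) :
    ghostInitial K q b • m = of G K (edge (q.edge b)) • ghostInitial K q (b + 1) • m := by
  obtain ⟨y, rfl⟩ := hm
  rw [smul_smul (ghostInitial K q (b + 1)), ghostInitial_mul_initial, initial, smul_smul,
    ← mul_assoc, ghostInitial_mul_initial, source_mul_edge, smul_smul, ← q.composable b,
    edge_mul_range]

end LeavittPathAlgebra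

end Algebra

section Chen

variable {V : Type u} {E : Type v} {G : DirectedGraph V E} {p : G.InfinitePath}

namespace ChenModule

theorem hom_ext {K : Type w} [Field K] {M : Type*} [AddCommGroup M] [Module K M] {f g : ChenModule K p →ₗ[K] M}
    (h : ∀ q, f (basisVec K q) = g (basisVec K q)) : f = g := by
  refine Finsupp.lhom_ext' (M := K) (R := K) (α := TailClass p) fun q => ?_
  ext
  exact h q

/-- The tail of a path in the class `[p]`. -/
def tail (q : TailClass p) (b : ℕ) : TailClass p := ⟨q.1.drop b, q.2.drop_left b⟩

theorem tail_zero (q : TailClass p) : tail q 0 = q := Subtype.ext q.1.drop_zero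

theorem exists_drop_eq (q q' : TailClass p) : ∃ a b, q'.1.drop a = q.1.drop b := by
  obtain ⟨a, b, -, -, h⟩ := q'.2.trans q.2.symm
  exact ⟨a, b, h⟩

end ChenModule

end Chen

variable {V : Type u} {E : Type v} [Fintype V] [Fintype E] {G : DirectedGraph V E}
  (K : Type w) [Field K]

namespace ChenModule

variable {p : G.InfinitePath}

theorem algebraMap_smul (k : K) (z : ChenModule K p) :
    algebraMap K (G.LeavittPathAlgebra K) k • z = k • z := by
  change act K (algebraMap K (G.LeavittPathAlgebra K) k) z = _
  rw [AlgHom.commutes]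
  rfl

instance : IsScalarTower K (G.LeavittPathAlgebra K) (ChenModule K p) :=
  IsScalarTower.of_algebraMap_smul fun k z => algebraMap_smul K k z

theorem vertex_smul (q : TailClass p) :
    of G K (vertex q.1.source) • basisVec K q = basisVec K q := by
  simp [of_smul_basisVec, genAct]

theorem ghost_smul_tail (q : TailClass p) (b : ℕ) :
    of G K (ghost (q.1.edge b)) • basisVec K (tail q b) = basisVec K (tail q (b + 1)) := by
  rw [of_smul_basisVec, genAct, if_pos (by simp [tail, InfinitePath.drop])]
  congr 2
  exact InfinitePath.drop_drop _ _ _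

theorem edge_smul_tail (q : TailClass p) (b : ℕ) :
    of G K (edge (q.1.edge b)) • basisVec K (tail q (b + 1)) = basisVec K (tail q b) := by
  have h : G.r (q.1.edge b) = (tail q (b + 1)).1.source := q.1.composable b
  rw [of_smul_basisVec, genAct, dif_pos h]
  congr 2
  ext i
  cases i with
  | zero => rfl
  | succ i => simp [InfinitePath.cons, tail, InfinitePath.drop, Nat.add_assoc, Nat.add_comm 1]

theorem initial_smul_tail (q : TailClass p) (b : ℕ) :
    initial K q.1 b • basisVec K (tail q b) = basisVec K q := by
  induction b with
  | zero => rw [tail_zero]; exact vertex_smul K q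
  | succ b ih => rw [initial, mul_smul, edge_smul_tail, ih]

theorem ghostInitial_smul (q : TailClass p) (b : ℕ) :
    ghostInitial K q.1 b • basisVec K q = basisVec K (tail q b) := by
  induction b with
  | zero => rw [tail_zero]; exact vertex_smul K q
  | succ b ih => rw [ghostInitial, mul_smul, ih, ghost_smul_tail]

theorem toSpanSingleton_basisVec_surjective (q : TailClass p) :
    Function.Surjective (LinearMap.toSpanSingleton (G.LeavittPathAlgebra K) _ (basisVec K q)) := by
  let f := (LinearMap.toSpanSingleton (G.LeavittPathAlgebra K) _ (basisVec K q)).restrictScalars K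
  have key (q' : TailClass p) : ∃ a : G.LeavittPathAlgebra K, a • basisVec K q = basisVec K q' := by
    obtain ⟨a, b, h⟩ := exists_drop_eq q q'
    refine ⟨initial K q'.1 a * ghostInitial K q.1 b, ?_⟩
    rw [mul_smul, ghostInitial_smul, ← show tail q' a = tail q b from Subtype.ext h,
      initial_smul_tail]
  choose a ha using key
  intro z
  let t : ChenModule K p →ₗ[K] G.LeavittPathAlgebra K :=
    (Finsupp.linearCombination K a : (TailClass p →₀ K) →ₗ[K] G.LeavittPathAlgebra K)
  have ht (q' : TailClass p) : t (basisVec K q') = a q' := by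
    change Finsupp.linearCombination K a (Finsupp.single q' 1) = a q'
    simp
  have h : f ∘ₗ t = LinearMap.id := hom_ext fun q' => by
    change t (basisVec K q') • basisVec K q = basisVec K q'
    rw [ht, ha]
  exact ⟨t z, LinearMap.congr_fun h z⟩

/-- A compatible family of elements indexed by the tails of `q` is annihilated by the
annihilator of `q`. -/
theorem smul_eq_zero_of_compatible (q : TailClass p) {M : Type*} [AddCommGroup M]
    [Module (G.LeavittPathAlgebra K) M] {x : ℕ → M}
    (hx : ∀ b, x b = of G K (edge (q.1.edge b)) • x (b + 1))
    (hq : ∀ b b', q.1.drop b = q.1.drop b' → x b = x b')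
    {a : G.LeavittPathAlgebra K} (ha : a • basisVec K q = 0) : a • x 0 = 0 := by
  let _ : Module K M := Module.compHom M (algebraMap K (G.LeavittPathAlgebra K))
  have : IsScalarTower K (G.LeavittPathAlgebra K) M :=
    IsScalarTower.of_algebraMap_smul fun _ _ => rfl
  have hv (b : ℕ) : of G K (vertex (G.s (q.1.edge b))) • x b = x b := by
    rw [hx b, smul_smul, source_mul_edge]
  have hi (b k : ℕ) : initial K (q.1.drop b) k • x (b + k) = x b := by
    induction k with
    | zero => exact hv b
    | succ k ih =>
      rw [initial, mul_smul, InfinitePath.drop_edge, ← Nat.add_assoc, ← hx, ih]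
  have hshift {q' : TailClass p} {a b : ℕ} (h : q'.1.drop a = q.1.drop b) (k : ℕ) :
      initial K q'.1 (a + k) • x (b + k) = initial K q'.1 a • x b := by
    rw [initial_add, mul_smul, h, hi]
  choose A B hAB using exists_drop_eq q
  let y (q' : TailClass p) : M := initial K q'.1 (A q') • x (B q')
  have hy {q' : TailClass p} {a b : ℕ} (h : q'.1.drop a = q.1.drop b) :
      y q' = initial K q'.1 a • x b := by
    have h1 := hshift h (A q')
    have h2 := hshift (hAB q') a
    rw [← h1, Nat.add_comm a, hq (b + A q') (B q' + a), h2]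
    rw [← InfinitePath.drop_add_of_drop_eq h, ← InfinitePath.drop_add_of_drop_eq (hAB q'),
      Nat.add_comm]
  let φ : ChenModule K p →ₗ[K] M :=
    (Finsupp.linearCombination K y : (TailClass p →₀ K) →ₗ[K] M)
  have hφ (q' : TailClass p) : φ (basisVec K q') = y q' := by
    change Finsupp.linearCombination K y (Finsupp.single q' 1) = y q'
    simp
  have hφe {e : E} {q' : TailClass p} (h : G.r e = q'.1.source) :
      y ⟨q'.1.cons e h, q'.2.cons_left e h⟩ = of G K (edge e) • y q' := by
    rw [hy (q' := ⟨q'.1.cons e h, q'.2.cons_left e h⟩) (a := 1 + A q') (b := B q')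
        (by rw [Nat.add_comm, InfinitePath.drop_cons, hAB q']),
      initial_add, InfinitePath.drop_one_cons]
    simp only [initial, InfinitePath.source, InfinitePath.cons, source_mul_edge, mul_smul, y]
  have hyv (q' : TailClass p) : of G K (vertex q'.1.source) • y q' = y q' := by
    rw [smul_smul, vertex_mul_initial]
  have hgen (g : Generator V E) (q' : TailClass p) :
      φ (genAct K g q') = of G K g • y q' := by
    cases g with
    | vertex v =>
      rw [genAct]
      split_ifs with h
      · rw [hφ, ← h, hyv]
      · rw [map_zero, ← hyv, smul_smul, vertex_mul_of_ne _ _ (Ne.symm h), zero_smul]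
    | edge e =>
      rw [genAct]
      split_ifs with h
      · rw [hφ, hφe]
      · rw [map_zero, ← hyv, smul_smul, ← edge_mul_range, mul_assoc, vertex_mul_of_ne _ _ h,
          mul_zero, zero_smul]
    | ghost e =>
      have h1 : y q' = of G K (edge (q'.1.edge 0)) • y ⟨q'.1.drop 1, q'.2.drop_one_left⟩ := by
        rw [← hφe q'.1.source_drop_one.symm]
        congr 1
        exact Subtype.ext q'.1.cons_drop_one.symm
      rw [genAct]
      split_ifs with h
      · subst h
        rw [hφ, h1, smul_smul, ghost_mul_edge, ← InfinitePath.source_drop_one]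
        exact (hyv ⟨q'.1.drop 1, q'.2.drop_one_left⟩).symm
      · rw [map_zero, h1, smul_smul, ghost_mul_edge_of_ne _ _ (Ne.symm h), zero_smul]
  have hlin (a : G.LeavittPathAlgebra K) : ∀ z, φ (a • z) = a • φ z := by
    induction a using LeavittPathAlgebra.induction with
    | algebraMap k =>
      intro z
      rw [_root_.algebraMap_smul, _root_.algebraMap_smul, map_smul]
    | of g =>
      have h : φ ∘ₗ Algebra.lsmul K K (ChenModule K p) (of G K g) =
          Algebra.lsmul K K M (of G K g) ∘ₗ φ := hom_ext fun q' => by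
        change φ (of G K g • basisVec K q') = of G K g • φ (basisVec K q')
        rw [of_smul_basisVec, hgen, hφ]
      exact fun z => LinearMap.congr_fun h z
    | mul a b ha hb => intro z; rw [mul_smul, ha, hb, mul_smul]
    | add a b ha hb => intro z; rw [add_smul, map_add, ha, hb, add_smul]
  have hq0 : φ (basisVec K q) = x 0 := by
    rw [hφ, hy (a := 0) (b := 0) rfl]
    exact hv 0
  rw [← hq0, ← hlin, ha, map_zero]

/-- The annihilators of the initial segments of `q` form an increasing sequence. -/
noncomputable def initialAnnihilator (q : G.InfinitePath) :
    ℕ →o Submodule (G.LeavittPathAlgebra K) (G.LeavittPathAlgebra K) where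
  toFun b := LinearMap.ker (LinearMap.toSpanSingleton _ _ (initial K q b))
  monotone' := monotone_nat_of_le_succ fun b a ha => by
    rw [LinearMap.mem_ker, LinearMap.toSpanSingleton_apply, smul_eq_mul] at ha ⊢
    rw [initial, ← mul_assoc, ha, zero_mul]

theorem mem_initialAnnihilator {q : G.InfinitePath} {b : ℕ} {a : G.LeavittPathAlgebra K} :
    a ∈ initialAnnihilator K q b ↔ a * initial K q b = 0 := Iff.rfl

/-- The annihilator of a path without repeated tails is the union of the annihilators of its
initial segments. -/
theorem ker_toSpanSingleton_le (q : TailClass p)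
    (hq : Function.Injective fun n => q.1.drop n) :
    LinearMap.ker (LinearMap.toSpanSingleton (G.LeavittPathAlgebra K) _ (basisVec K q)) ≤
      ⨆ b, initialAnnihilator K q.1 b := by
  intro a ha
  let N := ⨆ b, initialAnnihilator K q.1 b
  have h := smul_eq_zero_of_compatible K q
    (x := fun b => ghostInitial K q.1 b • N.mkQ 1) (fun b => by
      refine ghostInitial_smul_eq K q.1 b ⟨N.mkQ (ghostInitial K q.1 (b + 1)), ?_⟩
      rw [← map_smul, ← sub_eq_zero, ← map_sub, Submodule.mkQ_apply, Submodule.Quotient.mk_eq_zero]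
      refine Submodule.mem_iSup_of_mem (b + 1) ?_
      rw [mem_initialAnnihilator, sub_mul, smul_eq_mul, mul_assoc, ghostInitial_mul_initial,
        initial_mul_vertex, one_mul, sub_self])
    (fun b b' hbb => by rw [hq hbb]) (a := a) ha
  rw [smul_smul, ← map_smul, Submodule.mkQ_apply, Submodule.Quotient.mk_eq_zero, smul_eq_mul,
    mul_one] at h
  have h0 : a * (1 - of G K (vertex q.1.source)) ∈ N := by
    refine Submodule.mem_iSup_of_mem 0 ?_
    rw [mem_initialAnnihilator, mul_assoc, sub_mul, one_mul, vertex_mul_initial, sub_self,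
      mul_zero]
  have := N.add_mem h h0
  rwa [ghostInitial, ← mul_add, add_sub_cancel, mul_one] at this

/-- The Chen module of a path without repeated tails is not finitely presented. -/
theorem not_finitePresentation (p : G.InfinitePath)
    (hp : Function.Injective fun n => p.drop n) :
    ¬ Module.FinitePresentation (G.LeavittPathAlgebra K) (ChenModule K p) := by
  intro hfp
  let q : TailClass p := ⟨p, .refl p⟩
  have hfg := Module.FinitePresentation.fg_ker _ (toSpanSingleton_basisVec_surjective K q)
  obtain ⟨b, hb⟩ : ∃ b, LinearMap.ker (LinearMap.toSpanSingleton (G.LeavittPathAlgebra K) _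
      (basisVec K q)) = initialAnnihilator K p b := by
    refine hfg.stabilizes_of_iSup_eq _ (le_antisymm (iSup_le fun b a ha => ?_)
      (ker_toSpanSingleton_le K q hp))
    rw [LinearMap.mem_ker, LinearMap.toSpanSingleton_apply, ← initial_smul_tail K q b, smul_smul,
      (mem_initialAnnihilator K).1 ha, zero_smul]
  obtain ⟨i, hbi, f, hf, hne⟩ := p.exists_branch hp b
  refine ghost_ne_zero G K f ?_
  have hmem : of G K (ghost f) * ghostInitial K p i ∈ LinearMap.ker
      (LinearMap.toSpanSingleton (G.LeavittPathAlgebra K) _ (basisVec K q)) := by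
    rw [LinearMap.mem_ker, LinearMap.toSpanSingleton_apply, mul_smul, ghostInitial_smul K q,
      ← edge_smul_tail, smul_smul, ghost_mul_edge_of_ne _ _ hne, zero_smul]
  have h := (initialAnnihilator K p).monotone hbi (hb ▸ hmem)
  rwa [mem_initialAnnihilator, mul_assoc, ghostInitial_mul_initial, ← hf, ghost_mul_source] at h

/-- The Chen module of a path with a periodic tail is finitely presented. -/
theorem finitePresentation (q : TailClass p) {n : ℕ} (hn : 0 < n) (hqn : q.1.drop n = q.1) :
    Module.FinitePresentation (G.LeavittPathAlgebra K) (ChenModule K p) := by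
  set d := Function.minimalPeriod (InfinitePath.drop 1) q.1 with hd
  have hd0 : 0 < d := Function.IsPeriodicPt.minimalPeriod_pos hn
    (by rw [Function.IsPeriodicPt, Function.IsFixedPt, InfinitePath.iterate_drop_one, hqn])
  have hqd : q.1.drop d = q.1 := by
    rw [← InfinitePath.iterate_drop_one, hd, Function.iterate_minimalPeriod]
  let N := Submodule.span (G.LeavittPathAlgebra K) {1 - initial K q.1 d}
  have hm : initial K q.1 d • N.mkQ 1 = N.mkQ 1 := by
    rw [← map_smul, eq_comm, ← sub_eq_zero, ← map_sub, Submodule.mkQ_apply,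
      Submodule.Quotient.mk_eq_zero, smul_eq_mul, mul_one]
    exact Submodule.mem_span_singleton_self _
  have hv : of G K (vertex q.1.source) • N.mkQ 1 = N.mkQ 1 := by
    rw [← hm, smul_smul, vertex_mul_initial]
  have hdiv (k b : ℕ) (hb : b ≤ k * d) : ∃ y, initial K q.1 b • y = N.mkQ 1 := by
    obtain ⟨j, hj⟩ := Nat.exists_eq_add_of_le hb
    suffices ∃ y, initial K q.1 (b + j) • y = N.mkQ 1 by
      obtain ⟨y, hy⟩ := this
      exact ⟨initial K (q.1.drop b) j • y, by rw [smul_smul, ← initial_add, hy]⟩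
    rw [← hj]
    clear hj hb
    refine ⟨N.mkQ 1, ?_⟩
    induction k with
    | zero => rw [Nat.zero_mul]; exact hv
    | succ k ih => rw [Nat.succ_mul, Nat.add_comm, initial_add, hqd, mul_smul, ih, hm]
  have hghost : ghostInitial K q.1 d • N.mkQ 1 = N.mkQ 1 := by
    conv_lhs => rw [← hm]
    have h : G.s (q.1.edge d) = q.1.source := by
      conv_rhs => rw [← hqd]
      rfl
    rw [smul_smul, ghostInitial_mul_initial, h, hv]
  have hmod (b : ℕ) : ghostInitial K q.1 b • N.mkQ 1 = ghostInitial K q.1 (b % d) • N.mkQ 1 := by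
    induction b using Nat.strong_induction_on with
    | _ b ih =>
      rcases lt_or_ge b d with h | h
      · rw [Nat.mod_eq_of_lt h]
      · obtain ⟨c, rfl⟩ := Nat.exists_eq_add_of_le h
        rw [ghostInitial_add, hqd, mul_smul, hghost, ih c (by omega), Nat.add_mod_left]
  refine Module.finitePresentation_of_surjective _ (toSpanSingleton_basisVec_surjective K q) ?_
  suffices LinearMap.ker (LinearMap.toSpanSingleton (G.LeavittPathAlgebra K) _ (basisVec K q)) = N by
    rw [this]
    exact Submodule.fg_span_singleton _
  refine le_antisymm (fun a ha => ?_) ?_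
  · have h := smul_eq_zero_of_compatible K q (x := fun b => ghostInitial K q.1 b • N.mkQ 1)
      (fun b => ghostInitial_smul_eq K q.1 b (hdiv (b + 1) (b + 1) (Nat.le_mul_of_pos_right _ hd0)))
      (fun b b' hbb => by
        have h : b % d = b' % d := by
          refine Function.iterate_injOn_Iio_minimalPeriod (f := InfinitePath.drop 1) (x := q.1)
            (Nat.mod_lt _ hd0) (Nat.mod_lt _ hd0) ?_
          simp only [hd, Function.iterate_mod_minimalPeriod_eq]
          rw [InfinitePath.iterate_drop_one, InfinitePath.iterate_drop_one, hbb]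
        rw [hmod b, hmod b', h]) (a := a) ha
    rw [ghostInitial, hv, ← map_smul, Submodule.mkQ_apply, Submodule.Quotient.mk_eq_zero,
      smul_eq_mul, mul_one] at h
    exact h
  · rw [Submodule.span_singleton_le_iff_mem, LinearMap.mem_ker, LinearMap.toSpanSingleton_apply,
      sub_smul, one_smul, sub_eq_zero]
    conv_lhs => rw [← initial_smul_tail K q d]
    rw [show tail q d = q from Subtype.ext hqd]

end ChenModule

end DirectedGraph

open DirectedGraph in
theorem mainTheorem4 {V : Type u} {E : Type v} [Fintype V] [Fintype E]
    (G : DirectedGraph V E) (K : Type w) [Field K] (p : G.InfinitePath) :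
    Module.FinitePresentation (G.LeavittPathAlgebra K) (DirectedGraph.ChenModule K p) ↔
      ∃ c : G.ClosedPath, p.TailEquivalent c.infinitePower := by
  refine ⟨fun h => ?_, ?_⟩
  · by_contra hp
    refine ChenModule.not_finitePresentation K p (fun i j hij => ?_) h
    by_contra hne
    rcases Nat.lt_or_gt_of_ne hne with h | h
    · exact hp (p.exists_tailEquivalent_infinitePower h hij)
    · exact hp (p.exists_tailEquivalent_infinitePower h hij.symm)
  · rintro ⟨c, hc⟩
    exact ChenModule.finitePresentation K ⟨c.infinitePower, hc.symm⟩ c.length_pos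
      c.drop_infinitePower
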